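/- Let $(X,|\cdot|)$ be a real Banach space and $K\subset X$ a closed convex set with $\lambda K\subset K$ for all $\lambda\ge 0$ and $K\neq\{0\}$ (for instance $K=X$); assume that $K$ is not a finite-dimensional linear subspace of $X$. For $\rho>0$ put $K_\rho=\{v\in K: |v|=\rho\}$. Let $T:K\to K$ be completely continuous (continuous, and mapping bounded sets to relatively compact sets) and let $\mathcal F:K\times K\times K_1\to\mathbb R$ be continuous. For $v\in K_1$ and $t>0$ let $$\mathcal E(v)(t)=\int_0^t\mathcal F(T(sv),sv,v)\,ds .$$ Say that a pair $(r,R)$ with $0\le r<R\le\infty$, $r$ real, is *admissible* if the following holds, where $[r,R]$ denotes $\{t\in(0,\infty): r\le t\le R\}$. (h1) There are real $r_0>0$ and $R_0$ with $r\le r_0<R_0\le R$ such that for every $v\in K_1$ the function $\mathcal E(v)$ attains its maximum on $[r,R]$ at a unique point $t_v$, and $r_0<t_v<R_0$. Moreover, with $U_b=\{t_v v: v\in K_1\}$, at least one of the sets of conditions {(h2),(h3)}, {(h2),(h4),(h6)}, {(h2),(h5),(h7)} is satisfied, where (h2) $\inf_{u\in U_b}|T(u)|>0$; (h3), (h4),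 (h5) if $\mathcal F\left(tu,u,\frac{u}{|u|}\right)=0$ for some $t>0$ and $u\in K\setminus\{0\}$, then respectively $t=1$, $t\ge 1$, $t\le 1$; (h6) $|T(u)|\le|u|$ for all $u\in U_b$; (h7) $|T(u)|\ge|u|$ for all $u\in U_b$. **Theorem.** (1) If $(r_i,R_i)$, $i=1,\dots,n$, are admissible pairs with $r_i<R_i\le r_{i+1}$ for $i=1,\dots,n-1$, then $T$ has $n$ distinct fixed points $u_i\in K$ with $r_i<|u_i|<R_i$, $i=1,\dots,n$. (2) If $(r_i,R_i)$, $i=1,2,\dots$, are admissible pairs with $r_i<R_i\le r_{i+1}$ for $i=1,2,\dots$, then $T$ has a sequence of pairwise distinct fixed points $u_i\in K$ with $r_i<|u_i|<R_i$, $i=1,2,\dots$. (3) If $(r_i,R_i)$, $i=1,2,\dots$, are admissible pairs with $r_{i+1}<R_{i+1}\le r_i$ for $i=1,2,\dots$, then $T$ has a sequence of pairwise distinct fixed points $u_i\in K$ with $r_i<|u_i|<R_i$, $i=1,2,\dots$. -/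

import Mathlib

namespace Nehari

variable {X : Type*} [NormedAddCommGroup X] [NormedSpace ℝ X]

/-- The part `K_ρ` of the cone `K` on the sphere of radius `ρ`. A `ProperCone ℝ X` is a closed
convex set containing `0` and stable under multiplication by nonnegative scalars (a closed wedge);
it is not required to satisfy `K ∩ (-K) = {0}`. -/
def sphereIn (K : ProperCone ℝ X) (ρ : ℝ) : Set X := {v | v ∈ K ∧ ‖v‖ = ρ}

/-- `T` is a completely continuous operator `K → K`: it maps `K` into `K`, is continuous on `K`,
and maps bounded subsets of `K` to relatively compact sets. Only the values on `K` matter. -/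
structure IsCompletelyContinuous (K : ProperCone ℝ X) (T : X → X) : Prop where
  mapsTo : Set.MapsTo T (K : Set X) (K : Set X)
  continuousOn : ContinuousOn T (K : Set X)
  compact : ∀ B : Set X, B ⊆ (K : Set X) → Bornology.IsBounded B → IsCompact (closure (T '' B))

/-- `F` is a continuous functional `K × K × K_1 → ℝ`. Only the values there matter. -/
def IsContinuousFunctional (K : ProperCone ℝ X) (F : X → X → X → ℝ) : Prop :=
  ContinuousOn (fun p : X × X × X => F p.1 p.2.1 p.2.2)
    ((K : Set X) ×ˢ ((K : Set X) ×ˢ sphereIn K 1))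

/-- The radial energy in direction `v`: `t ↦ ∫₀ᵗ F (T (s v), s v, v) ds`, for `t > 0`. -/
noncomputable def energy (T : X → X) (F : X → X → X → ℝ) (v : X) (t : ℝ) : ℝ :=
  ∫ s in (0 : ℝ)..t, F (T (s • v)) (s • v) v

/-- The interval `[r, R]` inside the domain `(0, ∞)` of the radial energy
(`R = ⊤` is allowed and gives `[r, ∞)`). -/
def radii (r : ℝ) (R : EReal) : Set ℝ := {t | 0 < t ∧ r ≤ t ∧ (t : EReal) ≤ R}

/-- `t` is a point of `[r, R]` at which the radial energy in direction `v` attains its maximum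
over `[r, R]`. -/
def IsMaxRadius (T : X → X) (F : X → X → X → ℝ) (r : ℝ) (R : EReal) (v : X) (t : ℝ) : Prop :=
  t ∈ radii r R ∧ ∀ s ∈ radii r R, energy T F v s ≤ energy T F v t

/-- Condition (h1): for suitable `r ≤ r₀ < R₀ ≤ R` with `0 < r₀`, `R₀ < ∞`, and every `v ∈ K_1`,
the radial energy has a unique maximum point `t_v` on `[r, R]`, and `r₀ < t_v < R₀`. -/
def H1 (K : ProperCone ℝ X) (T : X → X) (F : X → X → X → ℝ) (r : ℝ) (R : EReal) : Prop :=
  ∃ r₀ R₀ : ℝ, 0 < r₀ ∧ r ≤ r₀ ∧ r₀ < R₀ ∧ (R₀ : EReal) ≤ R ∧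
    ∀ v ∈ sphereIn K 1, ∃ t : ℝ, IsMaxRadius T F r R v t ∧
      (∀ t', IsMaxRadius T F r R v t' → t' = t) ∧ r₀ < t ∧ t < R₀

/-- The Nehari-type manifold `U_b = {t_v v : v ∈ K_1}` (under (h1), `t_v` is the only `t` with
`IsMaxRadius T F r R v t`). -/
def manifold (K : ProperCone ℝ X) (T : X → X) (F : X → X → X → ℝ) (r : ℝ) (R : EReal) : Set X :=
  {u | ∃ v ∈ sphereIn K 1, ∃ t : ℝ, IsMaxRadius T F r R v t ∧ u = t • v}

/-- Condition (h2): `inf_{u ∈ U_b} |T u| > 0`. -/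
def H2 (K : ProperCone ℝ X) (T : X → X) (F : X → X → X → ℝ) (r : ℝ) (R : EReal) : Prop :=
  0 < ⨅ u : manifold K T F r R, ‖T u‖

/-- Condition (h3). -/
def H3 (K : ProperCone ℝ X) (F : X → X → X → ℝ) : Prop :=
  ∀ t : ℝ, 0 < t → ∀ u ∈ K, u ≠ 0 → F (t • u) u (‖u‖⁻¹ • u) = 0 → t = 1

/-- Condition (h4). -/
def H4 (K : ProperCone ℝ X) (F : X → X → X → ℝ) : Prop :=
  ∀ t : ℝ, 0 < t → ∀ u ∈ K, u ≠ 0 → F (t • u) u (‖u‖⁻¹ • u) = 0 → 1 ≤ t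

/-- Condition (h5). -/
def H5 (K : ProperCone ℝ X) (F : X → X → X → ℝ) : Prop :=
  ∀ t : ℝ, 0 < t → ∀ u ∈ K, u ≠ 0 → F (t • u) u (‖u‖⁻¹ • u) = 0 → t ≤ 1

/-- Condition (h6): `T` is compressive. -/
def H6 (K : ProperCone ℝ X) (T : X → X) (F : X → X → X → ℝ) (r : ℝ) (R : EReal) : Prop :=
  ∀ u ∈ manifold K T F r R, ‖T u‖ ≤ ‖u‖

/-- Condition (h7): `T` is expansive. -/
def H7 (K : ProperCone ℝ X) (T : X → X) (F : X → X → X → ℝ) (r : ℝ) (R : EReal) : Prop :=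
  ∀ u ∈ manifold K T F r R, ‖u‖ ≤ ‖T u‖

/-- The conditions under which the one-annulus existence theorem applies to the pair `(r, R)`,
`0 ≤ r < R ≤ ∞`. -/
def Applies (K : ProperCone ℝ X) (T : X → X) (F : X → X → X → ℝ) (r : ℝ) (R : EReal) : Prop :=
  0 ≤ r ∧ (r : EReal) < R ∧ H1 K T F r R ∧
    ((H2 K T F r R ∧ H3 K F) ∨
     (H2 K T F r R ∧ H4 K F ∧ H6 K T F r R) ∨
     (H2 K T F r R ∧ H5 K F ∧ H7 K T F r R))

/-- `u` is a fixed point of `T` in `K` with `r < |u| < R`. -/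
def IsFixedPointIn (K : ProperCone ℝ X) (T : X → X) (r : ℝ) (R : EReal) (u : X) : Prop :=
  u ∈ K ∧ T u = u ∧ r < ‖u‖ ∧ (‖u‖ : EReal) < R

end Nehari

/-! By (h1) each ray through `v ∈ K_1` meets the manifold at one point `τ v • v`. Continuity of the
parametric integral and uniqueness of the maximum make `τ` continuous
(`continuousOn_of_isMaxRadius`). Hence `N v = T (τ v • v) / ‖T (τ v • v)‖` is a compact self-map of
the unit sphere of `K`, well defined by (h2). A fixed point `v` of `N` gives `u = τ v • v` with `T u
= λ u`, `λ > 0`. The maximum is interior, so the radial derivative `F (T u, u, v) = F (λ u, u,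
u/‖u‖)` vanishes, and the remaining hypotheses force `λ = 1` (`Applies.exists_fixedPoint`). Ordered
annuli then give distinct norms.

That `N` has a fixed point is `exists_fixedPoint_sphereIn`. Since `K` is not a finite-dimensional
subspace, the hull of a finite net in the sphere can be mapped continuously back to the sphere;
Schauder's projection then reduces the claim to Brouwer's theorem on a simplex, which is derived
from Scarf's combinatorial lemma. -/

namespace Nehari

/-! ### Scarf's lemma, by a parity argument. -/

section Scarf

variable {V I : Type*} [DecidableEq V] [Fintype I] [DecidableEq I]

/-- A finite set `S` is dominant for a family of rankings if no point beats, in every ranking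
simultaneously, all the minima over `S`. -/
def IsDominant (p : I → V → ℤ) (S : Finset V) : Prop :=
  ∀ y, ∃ i, ∀ x ∈ S, p i y ≤ p i x

/-- In a set of `|I|` points that does not carry all the colours, the number of points whose
removal leaves exactly the colours different from `i₀` is even. -/
lemma even_card_filter_erase (c : V → I) (i₀ : I) (S : Finset V)
    (hcard : S.card = Fintype.card I) (hS : S.image c ≠ Finset.univ) :
    Even (S.filter fun x => (S.erase x).image c = Finset.univ.erase i₀).card := by
  rcases (S.filter fun x => (S.erase x).image c = Finset.univ.erase i₀).eq_empty_or_nonempty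
    with h | ⟨x, hx⟩
  · simp [h]
  rw [Finset.mem_filter] at hx
  obtain ⟨hxS, hx⟩ := hx
  have hcx : c x ≠ i₀ := by
    intro h
    apply hS
    rw [← Finset.insert_erase hxS, Finset.image_insert, hx, h,
      Finset.insert_erase (Finset.mem_univ _)]
  have hinj : Set.InjOn c (S.erase x : Finset V) := by
    rw [← Finset.card_image_iff, hx, Finset.card_erase_of_mem hxS,
      Finset.card_erase_of_mem (Finset.mem_univ _), hcard, Finset.card_univ]
  have hmem : c x ∈ (S.erase x).image c := by rw [hx]; simp [hcx]
  obtain ⟨y, hy, hyx⟩ := Finset.mem_image.1 hmem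
  have hyne : y ≠ x := (Finset.mem_erase.1 hy).1
  have hyS : y ∈ S := (Finset.mem_erase.1 hy).2
  -- On `S.erase x` every colour but `i₀` occurs exactly once, and `y` is the one point there
  -- sharing the colour of `x`; so only `x` or `y` can be dropped.
  have key : (S.filter fun x => (S.erase x).image c = Finset.univ.erase i₀) = {x, y} := by
    ext z
    simp only [Finset.mem_filter, Finset.mem_insert, Finset.mem_singleton]
    constructor
    · rintro ⟨hzS, hz⟩
      by_contra! hne
      have hcz : c z ∈ (S.erase z).image c := by
        rw [hz, ← hx]
        exact Finset.mem_image_of_mem _ (Finset.mem_erase.2 ⟨hne.1, hzS⟩)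
      obtain ⟨w, hw, hwz⟩ := Finset.mem_image.1 hcz
      have hwS := Finset.mem_erase.1 hw
      have hzx : z ∈ (S.erase x : Finset V) := Finset.mem_erase.2 ⟨hne.1, hzS⟩
      by_cases hwx : w = x
      · subst hwx
        exact hne.2 (hinj hzx hy (by rw [← hwz, hyx]))
      · exact hwS.1 (hinj (Finset.mem_erase.2 ⟨hwx, hwS.2⟩) hzx hwz)
    · rintro (rfl | rfl)
      · exact ⟨hxS, hx⟩
      · refine ⟨hyS, ?_⟩
        rw [← hx]
        ext k
        simp only [Finset.mem_image, Finset.mem_erase]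
        constructor
        · rintro ⟨a, ⟨ha, haS⟩, rfl⟩
          by_cases hax : a = x
          · exact ⟨z, ⟨hyne, hyS⟩, by rw [hyx, hax]⟩
          · exact ⟨a, ⟨hax, haS⟩, rfl⟩
        · rintro ⟨a, ⟨ha, haS⟩, rfl⟩
          by_cases hay : a = z
          · exact ⟨x, ⟨hyne.symm, hxS⟩, by rw [hay, hyx]⟩
          · exact ⟨a, ⟨hay, haS⟩, rfl⟩
  rw [key, Finset.card_pair hyne.symm]
  exact even_two

omit [DecidableEq V] [Fintype I] [DecidableEq I] in
lemma IsDominant.mono {p : I → V → ℤ} {S S' : Finset V} (h : IsDominant p S) (hS : S' ⊆ S) :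
    IsDominant p S' := fun y => (h y).imp fun _ hi x hx => hi x (hS hx)

omit [Fintype I] [DecidableEq I] in
/-- A maximizer of the ranking `k` among the points beating all minima of `D` in the other
rankings completes `D` to a dominant set. -/
lemma IsDominant.insert_of_isMax {p : I → V → ℤ} {D : Finset V} (hD : IsDominant p D) {m : I → V}
    (hmem : ∀ i, m i ∈ D) (hm : ∀ i, ∀ x ∈ D, p i (m i) ≤ p i x) {k : I} (hk : ∀ x ∈ D, ∃ l, l ≠ k ∧ m l = x)
    {x : V} (hx : ∀ l, l ≠ k → p l (m l) < p l x)
    (hmax : ∀ y, (∀ l, l ≠ k → p l (m l) < p l y) → p k y ≤ p k x) :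
    x ∉ D ∧ IsDominant p (insert x D) := by
  refine ⟨fun hxD => ?_, fun y => ?_⟩
  · obtain ⟨l, hl, rfl⟩ := hk x hxD
    exact lt_irrefl _ (hx l hl)
  by_cases hy : ∀ l, l ≠ k → p l (m l) < p l y
  · refine ⟨k, fun z hz => ?_⟩
    rcases Finset.mem_insert.1 hz with rfl | hz
    · exact hmax y hy
    · obtain ⟨l, hl⟩ := hD x
      have hlk : l = k := by
        by_contra hlk
        exact (hx l hlk).not_ge (hl _ (hmem l))
      subst hlk
      exact (hmax y hy).trans (hl z hz)
  · push Not at hy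
    obtain ⟨l, hl, hly⟩ := hy
    refine ⟨l, fun z hz => ?_⟩
    rcases Finset.mem_insert.1 hz with rfl | hz
    · exact hly.trans (hx l hl).le
    · exact hly.trans (hm l z hz)

open Classical in
/-- A dominant set of `|I| - 1` points has exactly two completions, unless it lies on the
boundary. -/
lemma IsDominant.card_completions [Fintype V] {p : I → V → ℤ}
    (hp : ∀ i, Function.Injective (p i)) {D : Finset V} (hD : IsDominant p D) (hne : D.Nonempty)
    (hcard : D.card + 1 = Fintype.card I)
    (hbeat : ∀ k, ∃ x, ∀ l, l ≠ k → ∃ z ∈ D, p l z < p l x) :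
    (Finset.univ.filter fun x => x ∉ D ∧ IsDominant p (insert x D)).card = 2 := by
  have hmin : ∀ i, ∃ z ∈ D, ∀ x ∈ D, p i z ≤ p i x := fun i => D.exists_min_image (p i) hne
  choose m hmem hm using hmin
  have hsurj : ∀ x ∈ D, ∃ l, m l = x := by
    intro x hx
    obtain ⟨l, hl⟩ := hD x
    exact ⟨l, hp l (le_antisymm (hm l x hx) (hl _ (hmem l)))⟩
  -- The map `m` is onto `D` and `D` has one point fewer than `I`, so exactly two rankings `i`, `j`
  -- share their minimum. Each can be freed without losing a point of `D` as a minimum.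
  obtain ⟨i, -, j, -, hij, hmij⟩ := Finset.exists_ne_map_eq_of_card_lt_of_maps_to
    (s := (Finset.univ : Finset I)) (t := D) (f := m) (by rw [Finset.card_univ]; omega)
    (fun a _ => hmem a)
  have hki : ∀ x ∈ D, ∃ l, l ≠ i ∧ m l = x := by
    intro x hx
    obtain ⟨l, rfl⟩ := hsurj x hx
    by_cases h : l = i
    · exact ⟨j, hij.symm, by rw [h, hmij]⟩
    · exact ⟨l, h, rfl⟩
  have hkj : ∀ x ∈ D, ∃ l, l ≠ j ∧ m l = x := by
    intro x hx
    obtain ⟨l, rfl⟩ := hsurj x hx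
    by_cases h : l = j
    · exact ⟨i, hij, by rw [h, hmij]⟩
    · exact ⟨l, h, rfl⟩
  have hmax : ∀ k, ∃ x, (∀ l, l ≠ k → p l (m l) < p l x) ∧
      ∀ y, (∀ l, l ≠ k → p l (m l) < p l y) → p k y ≤ p k x := by
    intro k
    obtain ⟨x₀, hx₀⟩ := hbeat k
    obtain ⟨x, hx, hxm⟩ := (Finset.univ.filter fun x => ∀ l, l ≠ k → p l (m l) < p l x
      ).exists_max_image (p k) ⟨x₀, by
        simp only [Finset.mem_filter, Finset.mem_univ, true_and]
        intro l hl
        obtain ⟨z, hz, hlt⟩ := hx₀ l hl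
        exact (hm l z hz).trans_lt hlt⟩
    simp only [Finset.mem_filter, Finset.mem_univ, true_and] at hx hxm
    exact ⟨x, hx, hxm⟩
  -- In a completion the points of `D` remain minima in all rankings but one, `k`, where `x` takes
  -- over. As `i` and `j` have the same minimizer in `D`, one of them must be `k`.
  have hdec : ∀ x, x ∉ D → IsDominant p (insert x D) →
      ∃ k, (k = i ∨ k = j) ∧ (∀ l, l ≠ k → p l (m l) < p l x) ∧
        ∀ y, (∀ l, l ≠ k → p l (m l) < p l y) → p k y ≤ p k x := by
    intro x hxD hx
    obtain ⟨k, hk⟩ := hx x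
    choose g hg using hx
    have hgm : ∀ z ∈ D, m (g z) = z := fun z hz =>
      hp _ (le_antisymm (hm _ z hz) (hg z _ (Finset.mem_insert_of_mem (hmem _))))
    have hgk : ∀ z ∈ D, g z ≠ k := by
      rintro z hz rfl
      have : x = z := hp _ (le_antisymm (hk z (Finset.mem_insert_of_mem hz))
        (hg z x (Finset.mem_insert_self _ _)))
      exact hxD (this ▸ hz)
    have himg : D.image g = Finset.univ.erase k := by
      apply Finset.eq_of_subset_of_card_le
      · intro l hl
        obtain ⟨z, hz, rfl⟩ := Finset.mem_image.1 hl
        exact Finset.mem_erase.2 ⟨hgk z hz, Finset.mem_univ _⟩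
      · rw [Finset.card_image_of_injOn, Finset.card_erase_of_mem (Finset.mem_univ _),
          Finset.card_univ, ← hcard]
        · simp
        · intro a ha b hb hab
          rw [← hgm a ha, ← hgm b hb, hab]
    have hgs : ∀ l, l ≠ k → ∃ z ∈ D, g z = l := fun l hl =>
      Finset.mem_image.1 (himg ▸ Finset.mem_erase.2 ⟨hl, Finset.mem_univ _⟩)
    have hxk : ∀ l, l ≠ k → p l (m l) < p l x := by
      intro l hl
      obtain ⟨z, hz, rfl⟩ := hgs l hl
      rw [hgm z hz]
      refine lt_of_le_of_ne (hg z x (Finset.mem_insert_self _ _)) fun h => hxD ?_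
      rw [← hp _ h]; exact hz
    refine ⟨k, ?_, hxk, fun y hy => ?_⟩
    · by_contra! hne
      obtain ⟨a, ha, hai⟩ := hgs i hne.1.symm
      obtain ⟨b, hb, hbj⟩ := hgs j hne.2.symm
      have hab : a = b := by rw [← hgm a ha, ← hgm b hb, hai, hbj, hmij]
      exact hij (by rw [← hai, ← hbj, hab])
    · have hly := hg y
      by_cases h : g y = k
      · exact h ▸ hly x (Finset.mem_insert_self _ _)
      · exact absurd (hly _ (Finset.mem_insert_of_mem (hmem (g y)))) (hy _ h).not_ge
  obtain ⟨a, ha, hamax⟩ := hmax i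
  obtain ⟨b, hb, hbmax⟩ := hmax j
  -- A common point would beat the minima of `D` in every ranking, against dominance.
  have hab : a ≠ b := by
    rintro rfl
    obtain ⟨l, hl⟩ := hD a
    by_cases h : l = i
    · exact (hb l (h ▸ hij)).not_ge (hl _ (hmem l))
    · exact (ha l h).not_ge (hl _ (hmem l))
  have key : (Finset.univ.filter fun x => x ∉ D ∧ IsDominant p (insert x D)) = {a, b} := by
    ext x
    simp only [Finset.mem_filter, Finset.mem_univ, true_and, Finset.mem_insert,
      Finset.mem_singleton]
    constructor
    · rintro ⟨hxD, hx⟩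
      obtain ⟨k, rfl | rfl, h1, h2⟩ := hdec x hxD hx
      · exact Or.inl (hp _ (le_antisymm (hamax x h1) (h2 a ha)))
      · exact Or.inr (hp _ (le_antisymm (hbmax x h1) (h2 b hb)))
    · rintro (rfl | rfl)
      · exact hD.insert_of_isMax hmem hm hki ha hamax
      · exact hD.insert_of_isMax hmem hm hkj hb hbmax
  rw [key, Finset.card_pair hab]

open Classical in
/-- The boundary set of slack points other than `s i₀` has exactly one dominant completion. -/
lemma card_completions_slack [Fintype V] {p : I → V → ℤ}
    (hp : ∀ i, Function.Injective (p i)) (s : I → V) (hs : ∀ i y, p i (s i) ≤ p i y)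
    (hs' : ∀ i j, j ≠ i → ∀ y, y ∉ Set.range s → p i y < p i (s j))
    (hV : ∃ y, y ∉ Set.range s) (i₀ : I) :
    (Finset.univ.filter fun x => x ∉ (Finset.univ.erase i₀).image s ∧
      IsDominant p (insert x ((Finset.univ.erase i₀).image s))).card = 1 := by
  obtain ⟨y₀, hy₀⟩ := hV
  obtain ⟨x, hx, hxmax⟩ := (Finset.univ.filter fun x => x ∉ Set.range s).exists_max_image (p i₀)
    ⟨y₀, by simpa using hy₀⟩
  simp only [Finset.mem_filter, Finset.mem_univ, true_and] at hx hxmax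
  have hsl : ∀ {i y}, y ∉ Set.range s → ¬ p i y ≤ p i (s i) := fun {i y} hy h =>
    hy ⟨i, hp i (le_antisymm (hs i y) h)⟩
  have hmem : ∀ {j}, j ≠ i₀ → s j ∈ (Finset.univ.erase i₀).image s := fun hj =>
    Finset.mem_image_of_mem _ (Finset.mem_erase.2 ⟨hj, Finset.mem_univ _⟩)
  rw [Finset.card_eq_one]
  refine ⟨x, ?_⟩
  ext z
  simp only [Finset.mem_filter, Finset.mem_univ, true_and, Finset.mem_singleton]
  constructor
  · rintro ⟨hzD, hz⟩
    have hzr : z ∉ Set.range s := by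
      rintro ⟨j, rfl⟩
      have hj : j = i₀ := by
        by_contra hj
        exact hzD (hmem hj)
      subst hj
      obtain ⟨i, hi⟩ := hz y₀
      refine hsl hy₀ (hi (s i) ?_)
      by_cases h : i = j
      · rw [h]; exact Finset.mem_insert_self _ _
      · exact Finset.mem_insert_of_mem (hmem h)
    obtain ⟨i, hi⟩ := hz x
    have : i = i₀ := by
      by_contra h
      exact hsl hx (hi _ (Finset.mem_insert_of_mem (hmem h)))
    subst this
    exact hp i (le_antisymm (hxmax z hzr) (hi z (Finset.mem_insert_self _ _)))
  · rintro rfl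
    refine ⟨fun h => ?_, fun y => ?_⟩
    · obtain ⟨j, -, hj⟩ := Finset.mem_image.1 h
      exact hx ⟨j, hj⟩
    · by_cases hy : y ∈ Set.range s
      · obtain ⟨j, rfl⟩ := hy
        exact ⟨j, fun w _ => hs j w⟩
      · refine ⟨i₀, fun w hw => ?_⟩
        rcases Finset.mem_insert.1 hw with rfl | hw
        · exact hxmax y hy
        · obtain ⟨j, hj, rfl⟩ := Finset.mem_image.1 hw
          exact (hs' i₀ j (Finset.mem_erase.1 hj).1 y hy).le

open Classical in
/-- Scarf's lemma: some dominant set carries all the colours. -/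
theorem exists_isDominant_image_eq_univ [Fintype V] [Nonempty I] {p : I → V → ℤ}
    (hp : ∀ i, Function.Injective (p i)) (s : I → V) (hs : ∀ i y, p i (s i) ≤ p i y)
    (hs' : ∀ i j, j ≠ i → ∀ y, y ∉ Set.range s → p i y < p i (s j))
    (hV : ∃ y, y ∉ Set.range s) (c : V → I) (hc : ∀ i, c (s i) = i) :
    ∃ S : Finset V, IsDominant p S ∧ S.image c = Finset.univ := by
  by_contra! hcon
  obtain ⟨i₀⟩ := ‹Nonempty I›
  set R : Finset (Finset V) :=
    Finset.univ.filter fun S => S.card = Fintype.card I ∧ IsDominant p S with hR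
  set E : Finset (Finset V) :=
    Finset.univ.filter fun D => D.card + 1 = Fintype.card I ∧ D.image c = Finset.univ.erase i₀
    with hE
  -- Double counting of pairs `(S, x)` with `S` dominant and `D = S.erase x` carrying all colours
  -- but `i₀`. Grouped by `S` the count is even if no dominant `S` is fully coloured; grouped by `D`
  -- it is odd, since the slack set contributes 1 and any other `D` contributes 0 or 2.
  have hsum : ∑ S ∈ R, (S.filter fun x => (S.erase x).image c = Finset.univ.erase i₀).card =
      ∑ D ∈ E, (Finset.univ.filter fun x => x ∉ D ∧ IsDominant p (insert x D)).card := by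
    rw [← Finset.card_sigma, ← Finset.card_sigma]
    refine Finset.card_bij' (fun a _ => ⟨a.1.erase a.2, a.2⟩) (fun a _ => ⟨insert a.2 a.1, a.2⟩)
      ?_ ?_ ?_ ?_
    · rintro ⟨S, x⟩ h
      simp only [Finset.mem_sigma, hR, hE, Finset.mem_filter, Finset.mem_univ, true_and] at h ⊢
      obtain ⟨⟨h1, h2⟩, h3, h4⟩ := h
      refine ⟨⟨?_, h4⟩, by simp, ?_⟩
      · rw [Finset.card_erase_add_one h3, h1]
      · rwa [Finset.insert_erase h3]
    · rintro ⟨D, x⟩ h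
      simp only [Finset.mem_sigma, hR, hE, Finset.mem_filter, Finset.mem_univ, true_and] at h ⊢
      obtain ⟨⟨h1, h2⟩, h3, h4⟩ := h
      refine ⟨⟨?_, h4⟩, by simp, ?_⟩
      · rw [Finset.card_insert_of_notMem h3, h1]
      · rwa [Finset.erase_insert h3]
    · rintro ⟨S, x⟩ h
      simp only [Finset.mem_sigma, Finset.mem_filter] at h
      simp [Finset.insert_erase h.2.1]
    · rintro ⟨D, x⟩ h
      simp only [Finset.mem_sigma, Finset.mem_filter, Finset.mem_univ, true_and] at h
      simp [Finset.erase_insert h.2.1]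
  have hsinj : Function.Injective s := fun a b h => by rw [← hc a, ← hc b, h]
  have heven : Even (∑ S ∈ R, (S.filter fun x =>
      (S.erase x).image c = Finset.univ.erase i₀).card) := by
    refine Finset.even_sum _ fun S hS => ?_
    simp only [hR, Finset.mem_filter, Finset.mem_univ, true_and] at hS
    exact even_card_filter_erase c i₀ S hS.1 (hcon S hS.2)
  have hD₀ : (Finset.univ.erase i₀).image s ∈ E := by
    simp only [hE, Finset.mem_filter, Finset.mem_univ, true_and]
    constructor
    · rw [Finset.card_image_of_injective _ hsinj, Finset.card_erase_add_one (Finset.mem_univ _),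
        Finset.card_univ]
    · rw [Finset.image_image]
      rw [show c ∘ s = id from funext hc, Finset.image_id]
  have hrest : Even (∑ D ∈ E.erase ((Finset.univ.erase i₀).image s),
      (Finset.univ.filter fun x => x ∉ D ∧ IsDominant p (insert x D)).card) := by
    refine Finset.even_sum _ fun D hD => ?_
    simp only [hE, Finset.mem_erase, Finset.mem_filter, Finset.mem_univ, true_and] at hD
    obtain ⟨hne, hcard, himg⟩ := hD
    by_cases hdom : IsDominant p D
    · have hz : ∃ z ∈ D, z ∉ Set.range s := by
        by_contra! hsub
        apply hne
        apply Finset.eq_of_subset_of_card_le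
        · intro z hz
          obtain ⟨j, rfl⟩ := hsub z hz
          refine Finset.mem_image_of_mem _ ?_
          rw [← himg, ← hc j]
          simpa [hc] using Finset.mem_image_of_mem c hz
        · rw [Finset.card_image_of_injective _ hsinj,
            Finset.card_erase_of_mem (Finset.mem_univ _), Finset.card_univ, ← hcard]
          simp
      obtain ⟨z, hzD, hz⟩ := hz
      rw [hdom.card_completions hp ⟨z, hzD⟩ hcard
        fun k => ⟨s k, fun l hl => ⟨z, hzD, hs' l k hl.symm z hz⟩⟩]
      exact even_two
    · have : (Finset.univ.filter fun x => x ∉ D ∧ IsDominant p (insert x D)) = ∅ := by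
        rw [Finset.filter_eq_empty_iff]
        rintro x - ⟨-, hx⟩
        exact hdom (hx.mono (Finset.subset_insert _ _))
      simp [this]
  rw [hsum, ← Finset.add_sum_erase _ _ hD₀, card_completions_slack hp s hs hs' hV i₀] at heven
  exact (Nat.not_even_iff_odd.2 (odd_one.add_even hrest)) heven

end Scarf

/-! ### Brouwer's theorem on the standard simplex, from Scarf's lemma. -/

section Brouwer

/-- Scarf's lemma without slack points. -/
theorem exists_nonempty_dominant_colours {T I : Type*} [Finite T] [Nonempty T] [Finite I]
    [Nonempty I] (q : I → T → ℕ) (hq : ∀ i, Function.Injective (q i)) (c : T → I) :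
    ∃ σ : Finset T, σ.Nonempty ∧
      ∀ y, ∃ i, (∃ z ∈ σ, c z = i) ∧ ∀ x ∈ σ, q i y ≤ q i x := by
  classical
  cases nonempty_fintype T
  cases nonempty_fintype I
  obtain ⟨M, hM⟩ : ∃ M, ∀ i t, q i t < M := by
    obtain ⟨M, hM⟩ := (Set.finite_range fun a : I × T => q a.1 a.2).bddAbove
    exact ⟨M + 1, fun i t => Nat.lt_succ_of_le (hM ⟨(i, t), rfl⟩)⟩
  let e := Fintype.equivFin I
  -- Slack point `j` lies below everything in its own ranking and above all of `T` in the others;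
  -- adding `e j` keeps the rankings injective.
  let p : I → T ⊕ I → ℤ := fun i => Sum.elim (fun t => (q i t : ℤ))
    fun j => if j = i then -1 else M + (e j : ℕ)
  have hpl : ∀ i t, p i (Sum.inl t) = q i t := fun i t => rfl
  have hpr : ∀ i j, p i (Sum.inr j) = if j = i then -1 else (M : ℤ) + (e j : ℕ) :=
    fun i j => rfl
  have hp : ∀ i, Function.Injective (p i) := by
    rintro i (a | a) (b | b) h
    · rw [hpl, hpl] at h
      exact congrArg Sum.inl (hq i (by exact_mod_cast h))
    · rw [hpl, hpr] at h
      have := hM i a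
      split_ifs at h; omega
    · rw [hpl, hpr] at h
      have := hM i b
      split_ifs at h; omega
    · rw [hpr, hpr] at h
      split_ifs at h with h1 h2 h2
      · rw [h1, h2]
      · omega
      · omega
      · have : e a = e b := Fin.ext (by omega)
        rw [e.injective this]
  obtain ⟨S, hS, hSc⟩ := exists_isDominant_image_eq_univ hp Sum.inr
    (by
      rintro i (a | a)
      · rw [hpl, hpr, if_pos rfl]; omega
      · rw [hpr, hpr, if_pos rfl]; split_ifs <;> omega)
    (by
      rintro i j hij (a | a) h
      · rw [hpl, hpr, if_neg hij]
        have := hM i a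
        omega
      · exact absurd ⟨a, rfl⟩ h)
    ⟨Sum.inl (Classical.arbitrary T), by simp⟩ (Sum.elim c id) (fun i => rfl)
  -- If colour `i` came from a slack point, that point's rank `-1` would bound `q i y` from above;
  -- so a genuine point carries it.
  have key : ∀ y, ∃ i, (∃ z ∈ S.toLeft, c z = i) ∧ ∀ x ∈ S.toLeft, q i y ≤ q i x := by
    intro y
    obtain ⟨i, hi⟩ := hS (Sum.inl y)
    refine ⟨i, ?_, fun x hx => by simpa [hpl] using hi _ (Finset.mem_toLeft.1 hx)⟩
    obtain ⟨z, hz, hzi⟩ := Finset.mem_image.1 (hSc ▸ Finset.mem_univ i)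
    rcases z with z | z
    · exact ⟨z, Finset.mem_toLeft.2 hz, hzi⟩
    · have hzi : z = i := hzi
      have := hi _ hz
      rw [hpl, hpr, if_pos hzi] at this
      omega
  obtain ⟨i, ⟨z, hz, -⟩, -⟩ := key (Classical.arbitrary T)
  exact ⟨S.toLeft, ⟨z, hz⟩, key⟩

/-- The grid points of mesh `1 / m` of the standard simplex, scaled by `m`. -/
abbrev SimplexGrid (I : Type*) [Fintype I] (m : ℕ) : Type _ :=
  {a : I → Fin (m + 1) // ∑ i, (a i : ℕ) = m}

lemma SimplexGrid.exists_eq {I : Type*} [Fintype I] {m : ℕ} (b : I → ℕ) (hb : ∑ i, b i = m) :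
    ∃ a : SimplexGrid I m, ∀ i, (a.1 i : ℕ) = b i :=
  ⟨⟨fun i => ⟨b i, Nat.lt_succ_of_le
    (hb ▸ Finset.single_le_sum (fun _ _ => Nat.zero_le _) (Finset.mem_univ i))⟩, hb⟩, fun _ => rfl⟩

/-- Every colouring of the grid has a small set of grid points carrying all colours, up to the
colours whose coordinate is small on the set. -/
theorem exists_small_coloured_set {I : Type*} [Fintype I] [Nonempty I] (m : ℕ)
    (c : SimplexGrid I m → I) :
    ∃ σ : Finset (SimplexGrid I m), σ.Nonempty ∧ ∃ μ : I → ℕ,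
      (∀ x ∈ σ, ∀ i, μ i ≤ x.1 i ∧ (x.1 i : ℕ) ≤ μ i + Fintype.card I) ∧
      ∀ i, μ i = 0 ∨ ∃ z ∈ σ, c z = i := by
  classical
  have : Nonempty (SimplexGrid I m) := by
    obtain ⟨a, -⟩ := SimplexGrid.exists_eq (m := m) (Pi.single (Classical.arbitrary I) m)
      (by rw [Finset.sum_pi_single']; simp)
    exact ⟨a⟩
  let e := Fintype.equivFin (SimplexGrid I m)
  set N := Fintype.card (SimplexGrid I m)
  -- Ranking by the `i`-th coordinate, ties broken by the enumeration `e`.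
  let q : I → SimplexGrid I m → ℕ := fun i a => a.1 i * N + e a
  have hqle : ∀ i a b, q i a ≤ q i b → (a.1 i : ℕ) ≤ b.1 i := by
    intro i a b h
    by_contra! hlt
    have h1 : ((b.1 i : ℕ) + 1) * N ≤ a.1 i * N := Nat.mul_le_mul_right _ hlt
    have h2 : (e b : ℕ) < N := (e b).2
    simp only [q] at h
    nlinarith
  have hq : ∀ i, Function.Injective (q i) := by
    intro i a b h
    have h1 := le_antisymm (hqle i a b h.le) (hqle i b a h.ge)
    simp only [q, h1] at h
    exact e.injective (Fin.ext (by omega))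
  obtain ⟨σ, hσ, hdom⟩ := exists_nonempty_dominant_colours q hq c
  refine ⟨σ, hσ, ?_⟩
  choose w hw hwm using fun i : I => σ.exists_min_image (fun a => (a.1 i : ℕ)) hσ
  set μ : I → ℕ := fun i => if ∃ z ∈ σ, c z = i then (w i).1 i else 0 with hμ
  have hμle : ∀ x ∈ σ, ∀ i, μ i ≤ x.1 i := by
    intro x hx i
    simp only [hμ]
    split_ifs
    · exact hwm i x hx
    · exact Nat.zero_le _
  -- Otherwise some grid point has every coordinate at least `μ i + 1` and beats the minima over `σ`
  -- in all rankings whose colour occurs. With the coordinates summing to `m`, this bounds the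
  -- spread of `σ`.
  have hlt : m < ∑ i, μ i + Fintype.card I := by
    by_contra! hle
    obtain ⟨a, ha⟩ := SimplexGrid.exists_eq (m := m)
      (fun i => (μ i + 1) + if i = Classical.arbitrary I then
        m - (∑ i, μ i + Fintype.card I) else 0) (by
        rw [Finset.sum_add_distrib, Finset.sum_add_distrib, Finset.sum_ite_eq']
        simp only [Finset.mem_univ, if_true, Finset.sum_const, Finset.card_univ, smul_eq_mul,
          mul_one]
        omega)
    obtain ⟨i, hi, hmin⟩ := hdom a
    have h1 := hqle i _ _ (hmin _ (hw i))
    rw [ha i] at h1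
    simp only [hμ, if_pos hi] at h1
    omega
  refine ⟨μ, fun x hx i => ⟨hμle x hx i, ?_⟩, fun i => ?_⟩
  · have h1 : ∑ j, (x.1 j : ℕ) = m := x.2
    rw [← Finset.add_sum_erase _ _ (Finset.mem_univ i)] at h1 hlt
    have h2 : ∑ j ∈ Finset.univ.erase i, μ j ≤ ∑ j ∈ Finset.univ.erase i, (x.1 j : ℕ) :=
      Finset.sum_le_sum fun j _ => hμle x hx j
    omega
  · simp only [hμ]
    split_ifs with h
    · exact Or.inr h
    · exact Or.inl rfl

/-- A grid point is coloured by a coordinate that `f` does not decrease; one exists because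
coordinates sum to 1 before and after. On a small coloured set each coordinate is either nearly
zero, or does not decrease at a nearby point, and uniform continuity transfers this to `x`. -/
theorem exists_approx_fixedPoint_stdSimplex {I : Type*} [Fintype I] [Nonempty I]
    {f : (I → ℝ) → I → ℝ} (hf : ContinuousOn f (stdSimplex ℝ I))
    (hmaps : Set.MapsTo f (stdSimplex ℝ I) (stdSimplex ℝ I)) {ε : ℝ} (hε : 0 < ε) :
    ∃ x ∈ stdSimplex ℝ I, ∀ i, x i - ε ≤ f x i := by
  have huc := (isCompact_stdSimplex ℝ I).uniformContinuousOn_of_continuous hf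
  rw [Metric.uniformContinuousOn_iff] at huc
  obtain ⟨δ, hδ, hfδ⟩ := huc (ε / 2) (half_pos hε)
  obtain ⟨m, hm⟩ := exists_nat_gt ((Fintype.card I : ℝ) / min δ (ε / 2))
  have hmin : 0 < min δ (ε / 2) := lt_min hδ (half_pos hε)
  have hm0 : (0 : ℝ) < m := lt_of_le_of_lt (by positivity) hm
  have hmesh : (Fintype.card I : ℝ) / m < min δ (ε / 2) := by
    rw [div_lt_iff₀ hmin] at hm
    rw [div_lt_iff₀ hm0]
    linarith
  let pt : SimplexGrid I m → I → ℝ := fun a i => (a.1 i : ℕ) / m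
  have hpt : ∀ a, pt a ∈ stdSimplex ℝ I := by
    intro a
    refine ⟨fun i => by positivity, ?_⟩
    simp only [pt]
    rw [← Finset.sum_div, ← Nat.cast_sum, a.2, div_self hm0.ne']
  have hcol : ∀ a, ∃ i, pt a i ≤ f (pt a) i := by
    intro a
    obtain ⟨i, -, hi⟩ := Finset.exists_le_of_sum_le (s := Finset.univ) Finset.univ_nonempty
      (f := pt a) (g := f (pt a)) (by rw [(hpt a).2, (hmaps (hpt a)).2])
    exact ⟨i, hi⟩
  choose c hc using hcol
  obtain ⟨σ, ⟨x, hx⟩, μ, hμ, hμc⟩ := exists_small_coloured_set m c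
  have hclose : ∀ a ∈ σ, ∀ i, |pt x i - pt a i| ≤ Fintype.card I / m := by
    intro a ha i
    simp only [pt]
    rw [← sub_div, abs_div, abs_of_pos hm0]
    gcongr
    obtain ⟨h1, h2⟩ := hμ x hx i
    obtain ⟨h3, h4⟩ := hμ a ha i
    have h1' : (μ i : ℝ) ≤ (x.1 i : ℕ) := by exact_mod_cast h1
    have h2' : ((x.1 i : ℕ) : ℝ) ≤ μ i + Fintype.card I := by exact_mod_cast h2
    have h3' : (μ i : ℝ) ≤ (a.1 i : ℕ) := by exact_mod_cast h3
    have h4' : ((a.1 i : ℕ) : ℝ) ≤ μ i + Fintype.card I := by exact_mod_cast h4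
    rw [abs_le]
    constructor <;> linarith
  refine ⟨pt x, hpt x, fun i => ?_⟩
  rcases hμc i with h | ⟨z, hz, rfl⟩
  · have h1 : ((x.1 i : ℕ) : ℝ) ≤ Fintype.card I := by
      have := (hμ x hx i).2
      rw [h, zero_add] at this
      exact_mod_cast this
    have h2 : pt x i ≤ Fintype.card I / m := by
      simp only [pt]
      gcongr
    have h3 := (hmaps (hpt x)).1 i
    linarith [hmesh.trans_le (min_le_right δ (ε / 2))]
  · have hd : dist (pt x) (pt z) < δ := by
      refine lt_of_le_of_lt ?_ (hmesh.trans_le (min_le_left _ _))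
      exact (dist_pi_le_iff (by positivity)).2 fun j => hclose z hz j
    have h1 := (dist_le_pi_dist _ _ (c z)).trans_lt (hfδ _ (hpt x) _ (hpt z) hd)
    rw [Real.dist_eq, abs_lt] at h1
    have h2 := abs_le.1 (hclose z hz (c z))
    have h3 := hc z
    linarith [hmesh.trans_le (min_le_right δ (ε / 2))]

/-- Brouwer's fixed point theorem for the standard simplex. -/
theorem exists_fixedPoint_stdSimplex {I : Type*} [Fintype I] [Nonempty I]
    {f : (I → ℝ) → I → ℝ} (hf : ContinuousOn f (stdSimplex ℝ I))
    (hmaps : Set.MapsTo f (stdSimplex ℝ I) (stdSimplex ℝ I)) :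
    ∃ x ∈ stdSimplex ℝ I, f x = x := by
  choose x hx hxf using fun n : ℕ => exists_approx_fixedPoint_stdSimplex hf hmaps
    (ε := 1 / ((n : ℝ) + 1)) Nat.one_div_pos_of_nat
  obtain ⟨y, hy, φ, hφ, hlim⟩ := (isCompact_stdSimplex ℝ I).tendsto_subseq hx
  have hflim : Filter.Tendsto (fun n => f (x (φ n))) Filter.atTop (nhds (f y)) :=
    (hf y hy).tendsto.comp (tendsto_nhdsWithin_iff.2 ⟨hlim, Filter.Eventually.of_forall
      fun n => hx (φ n)⟩)
  have hle : ∀ i, y i ≤ f y i := by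
    intro i
    have h1 : Filter.Tendsto (fun n => x (φ n) i - 1 / ((φ n : ℝ) + 1)) Filter.atTop
        (nhds (y i - 0)) :=
      ((tendsto_pi_nhds.1 hlim) i).sub
        (tendsto_one_div_add_atTop_nhds_zero_nat.comp hφ.tendsto_atTop)
    rw [sub_zero] at h1
    exact le_of_tendsto_of_tendsto' h1 (tendsto_pi_nhds.1 hflim i) fun n => hxf (φ n) i
  refine ⟨y, hy, ?_⟩
  -- Coordinatewise inequality between vectors of equal sum is equality.
  have hsum : ∑ i, y i = ∑ i, f y i := by rw [hy.2, (hmaps hy).2]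
  ext i
  exact ((Finset.sum_eq_sum_iff_of_le fun i _ => hle i).1 hsum i (Finset.mem_univ i)).symm

end Brouwer

/-! ### Fixed points of compact maps on the unit sphere of a cone. -/

section ConeSphere

variable {X : Type*} [NormedAddCommGroup X] [NormedSpace ℝ X]

/-- If the cone `K` is not a finite-dimensional subspace, then for any finite family in `K` there
is a unit vector of `K` whose opposite is not in the cone spanned by the family. -/
lemma exists_unit_neg_ne_sum (K : ProperCone ℝ X)
    (hdim : ∀ S : Submodule ℝ X, (S : Set X) = (K : Set X) → ¬ FiniteDimensional ℝ S)
    {ι : Type*} [Fintype ι] (f : ι → X) (hf : ∀ i, f i ∈ K) :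
    ∃ x ∈ K, ‖x‖ = 1 ∧ ∀ a : ι → ℝ, (∀ i, 0 ≤ a i) → ∑ i, a i • f i ≠ -x := by
  have hsumK : ∀ a : ι → ℝ, (∀ i, 0 ≤ a i) → ∑ i, a i • f i ∈ K := fun a ha =>
    sum_mem fun i _ => K.smul_mem (hf i) (ha i)
  suffices h : ∃ x ∈ K, x ≠ 0 ∧ ∀ a : ι → ℝ, (∀ i, 0 ≤ a i) → ∑ i, a i • f i ≠ -x by
    obtain ⟨x, hx, hx0, hne⟩ := h
    have hn : 0 < ‖x‖ := norm_pos_iff.2 hx0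
    refine ⟨‖x‖⁻¹ • x, K.smul_mem hx (by positivity), by
      rw [norm_smul, norm_inv, norm_norm, inv_mul_cancel₀ hn.ne'], fun a ha h => ?_⟩
    refine hne (fun i => ‖x‖ * a i) (fun i => mul_nonneg hn.le (ha i)) ?_
    simp_rw [mul_smul]
    rw [← Finset.smul_sum, h, smul_neg, smul_smul, mul_inv_cancel₀ hn.ne', one_smul]
  -- If `K` is symmetric it is an infinite-dimensional subspace, and any `x` outside the span of the
  -- family works; otherwise any `x ∈ K` with `-x ∉ K` does.
  by_cases hneg : ∀ x ∈ K, -x ∈ K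
  · let S : Submodule ℝ X :=
      { carrier := K
        add_mem' := fun ha hb => add_mem ha hb
        zero_mem' := zero_mem K
        smul_mem' := fun c x hx => by
          rcases le_total 0 c with hc | hc
          · exact K.smul_mem hx hc
          · rw [← neg_smul_neg]
            exact K.smul_mem (hneg x hx) (neg_nonneg.2 hc) }
    have hspan : Submodule.span ℝ (Set.range f) ≤ S := by
      rw [Submodule.span_le]
      rintro _ ⟨i, rfl⟩
      exact hf i
    obtain ⟨x, hxK, hx⟩ : ∃ x ∈ S, x ∉ Submodule.span ℝ (Set.range f) := by
      by_contra! hle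
      have hS : Submodule.span ℝ (Set.range f) = S := le_antisymm hspan hle
      refine hdim S rfl ?_
      rw [← hS]
      exact FiniteDimensional.span_of_finite ℝ (Set.finite_range f)
    refine ⟨x, hxK, fun h => hx (h ▸ zero_mem _), fun a _ h => hx ?_⟩
    rw [← neg_neg x, ← h]
    exact neg_mem (sum_mem fun i _ => Submodule.smul_mem _ _ (Submodule.subset_span ⟨i, rfl⟩))
  · push Not at hneg
    obtain ⟨x, hx, hnx⟩ := hneg
    refine ⟨x, hx, ?_, fun a ha h => hnx (h ▸ hsumK a ha)⟩
    rintro rfl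
    exact hnx (by simp)

/-- Approximate fixed points of a continuous self-map of the unit sphere of a cone, with totally
bounded image. -/
theorem exists_approx_fixedPoint_sphereIn (K : ProperCone ℝ X)
    (hdim : ∀ S : Submodule ℝ X, (S : Set X) = (K : Set X) → ¬ FiniteDimensional ℝ S)
    {N : X → X} (hN : ContinuousOn N (sphereIn K 1))
    (hmaps : Set.MapsTo N (sphereIn K 1) (sphereIn K 1))
    (htb : TotallyBounded (N '' sphereIn K 1)) {ε : ℝ} (hε : 0 < ε) :
    ∃ v ∈ sphereIn K 1, ‖v - N v‖ ≤ 4 * ε := by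
  classical
  obtain ⟨t, htN, htfin, hcov⟩ := htb.exists_subset (Metric.dist_mem_uniformity hε)
  have hfin : Fintype t := htfin.fintype
  have hf : ∀ i : t, (i : X) ∈ sphereIn K 1 := fun i => by
    obtain ⟨v, hv, hvi⟩ := htN i.2
    exact hvi ▸ hmaps hv
  obtain ⟨x₀, hx₀K, hx₀, hx₀ne⟩ := exists_unit_neg_ne_sum K hdim (fun i : t => (i : X))
    fun i => (hf i).1
  have hx₀S : x₀ ∈ sphereIn K 1 := ⟨hx₀K, hx₀⟩
  have hcov' : ∀ v ∈ sphereIn K 1, ∃ i : t, ‖N v - i‖ < ε := by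
    intro v hv
    have := hcov (Set.mem_image_of_mem N hv)
    simp only [Set.mem_iUnion, Set.mem_ofPred_eq, dist_eq_norm] at this
    obtain ⟨y, hy, hlt⟩ := this
    exact ⟨⟨y, hy⟩, hlt⟩
  have : Nonempty t := ⟨(hcov' x₀ hx₀S).choose⟩
  let w : (t → ℝ) → X := fun a => ∑ i, a i • (i : X)
  -- The push along `x₀` vanishes when `‖w a‖ = 1` and, by the choice of `x₀`, keeps `z a` away from
  -- 0, so `ρ` maps the simplex into the sphere. The `l i` are Schauder's weights for the `ε`-net
  -- `t`.
  let z : (t → ℝ) → X := fun a => w a + (1 - ‖w a‖) • x₀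
  let ρ : (t → ℝ) → X := fun a => ‖z a‖⁻¹ • z a
  let l : t → X → ℝ := fun i y => max 0 (ε - ‖y - i‖)
  let L : X → ℝ := fun y => ∑ i, l i y
  have hl0 : ∀ i y, 0 ≤ l i y := fun i y => le_max_left _ _
  have hLpos : ∀ v ∈ sphereIn K 1, 0 < L (N v) := by
    intro v hv
    obtain ⟨i, hi⟩ := hcov' v hv
    exact Finset.sum_pos' (fun i _ => hl0 i _)
      ⟨i, Finset.mem_univ _, lt_max_of_lt_right (sub_pos.2 hi)⟩
  have hwK : ∀ a ∈ stdSimplex ℝ t, w a ∈ K := fun a ha =>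
    sum_mem fun i _ => K.smul_mem (hf i).1 (ha.1 i)
  have hw1 : ∀ a ∈ stdSimplex ℝ t, ‖w a‖ ≤ 1 := by
    intro a ha
    refine (norm_sum_le _ _).trans ?_
    rw [← ha.2]
    refine Finset.sum_le_sum fun i _ => ?_
    rw [norm_smul, (hf i).2, mul_one, Real.norm_of_nonneg (ha.1 i)]
  have hz0 : ∀ a ∈ stdSimplex ℝ t, z a ≠ 0 := by
    intro a ha h
    rcases (hw1 a ha).lt_or_eq with hlt | heq
    · have hs : 0 < 1 - ‖w a‖ := sub_pos.2 hlt
      refine hx₀ne (fun i => (1 - ‖w a‖)⁻¹ * a i)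
        (fun i => mul_nonneg (inv_nonneg.2 hs.le) (ha.1 i)) ?_
      simp_rw [mul_smul]
      rw [← Finset.smul_sum]
      change (1 - ‖w a‖)⁻¹ • w a = -x₀
      refine (congrArg ((1 - ‖w a‖)⁻¹ • ·) (eq_neg_of_add_eq_zero_left h)).trans ?_
      rw [smul_neg, smul_smul, inv_mul_cancel₀ hs.ne', one_smul]
    · simp only [z, heq, sub_self, zero_smul, add_zero] at h
      rw [h, norm_zero] at heq
      exact zero_ne_one heq
  have hρ : ∀ a ∈ stdSimplex ℝ t, ρ a ∈ sphereIn K 1 := by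
    intro a ha
    refine ⟨K.smul_mem (add_mem (hwK a ha) (K.smul_mem hx₀K (sub_nonneg.2 (hw1 a ha))))
      (by positivity), ?_⟩
    rw [norm_smul, norm_inv, norm_norm, inv_mul_cancel₀ (norm_ne_zero_iff.2 (hz0 a ha))]
  have hzcont : Continuous z := by fun_prop
  have hρcont : ContinuousOn ρ (stdSimplex ℝ t) :=
    (hzcont.norm.continuousOn.inv₀ fun a ha => norm_ne_zero_iff.2 (hz0 a ha)).smul
      hzcont.continuousOn
  have hNρ : ContinuousOn (fun a => N (ρ a)) (stdSimplex ℝ t) := hN.comp hρcont hρ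
  have hlcont : ∀ i, Continuous (l i) := fun i => by fun_prop
  have hLcont : Continuous L := by fun_prop
  obtain ⟨a, ha, hfix⟩ := exists_fixedPoint_stdSimplex
    (f := fun a i => l i (N (ρ a)) / L (N (ρ a)))
    (continuousOn_pi.2 fun i => ((hlcont i).comp_continuousOn hNρ).div
      (hLcont.comp_continuousOn hNρ) fun a ha => (hLpos _ (hρ a ha)).ne')
    (fun a ha => ⟨fun i => div_nonneg (hl0 _ _) (hLpos _ (hρ a ha)).le, by
      rw [← Finset.sum_div]
      exact div_self (hLpos _ (hρ a ha)).ne'⟩)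
  have hai : ∀ i, a i = l i (N (ρ a)) / L (N (ρ a)) := fun i => (congrFun hfix i).symm
  set y := N (ρ a) with hy
  have hy1 : ‖y‖ = 1 := (hmaps (hρ a ha)).2
  -- At the Brouwer fixed point `w a` is the Schauder projection of `y`: only net points within `ε`
  -- of `y` have positive weight. The errors then add up as `2ε + ε + ε`.
  have hwy : ‖w a - y‖ ≤ ε := by
    have h1 : w a - y = ∑ i, a i • ((i : X) - y) := by
      simp_rw [smul_sub]
      rw [Finset.sum_sub_distrib, ← Finset.sum_smul, ha.2, one_smul]
    rw [h1]
    refine (norm_sum_le _ _).trans ?_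
    calc ∑ i, ‖a i • ((i : X) - y)‖ ≤ ∑ i, a i * ε := by
          refine Finset.sum_le_sum fun i _ => ?_
          rw [norm_smul, Real.norm_of_nonneg (ha.1 i)]
          by_cases hi : ‖y - i‖ < ε
          · rw [norm_sub_rev]
            exact mul_le_mul_of_nonneg_left hi.le (ha.1 i)
          · have : a i = 0 := by
              rw [hai i]
              simp only [l]
              rw [max_eq_left (by linarith), zero_div]
            simp [this]
      _ = ε := by rw [← Finset.sum_mul, ha.2, one_mul]
  have hs : 1 - ‖w a‖ ≤ ε := by
    have := norm_sub_norm_le y (w a)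
    rw [norm_sub_rev, hy1] at this
    linarith
  have hzw : ‖z a - w a‖ ≤ ε := by
    simp only [z]
    rw [add_sub_cancel_left, norm_smul, hx₀, mul_one,
      Real.norm_of_nonneg (sub_nonneg.2 (hw1 a ha))]
    exact hs
  have hρz : ‖ρ a - z a‖ ≤ 2 * ε := by
    have h0 : 0 < ‖z a‖ := norm_pos_iff.2 (hz0 a ha)
    have h1 : ρ a - z a = (‖z a‖⁻¹ - 1) • z a := by rw [sub_smul, one_smul]
    rw [h1, norm_smul, Real.norm_eq_abs, ← abs_of_pos h0, ← abs_mul, abs_of_pos h0, sub_mul,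
      inv_mul_cancel₀ h0.ne', one_mul, abs_le]
    have h2 := abs_le.1 ((abs_norm_sub_norm_le (z a) (w a)).trans hzw)
    have h3 := hw1 a ha
    constructor <;> linarith
  refine ⟨ρ a, hρ a ha, ?_⟩
  calc ‖ρ a - y‖ = ‖(ρ a - z a) + (z a - w a) + (w a - y)‖ := by congr 1; abel
    _ ≤ ‖ρ a - z a‖ + ‖z a - w a‖ + ‖w a - y‖ := norm_add₃_le
    _ ≤ 4 * ε := by linarith

lemma isClosed_sphereIn (K : ProperCone ℝ X) (ρ : ℝ) : IsClosed (sphereIn K ρ) :=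
  K.isClosed.inter (isClosed_eq continuous_norm continuous_const)

/-- The unit sphere of a closed cone which is not a finite-dimensional subspace has the fixed
point property for compact maps. -/
theorem exists_fixedPoint_sphereIn (K : ProperCone ℝ X)
    (hdim : ∀ S : Submodule ℝ X, (S : Set X) = (K : Set X) → ¬ FiniteDimensional ℝ S)
    {N : X → X} (hN : ContinuousOn N (sphereIn K 1))
    (hmaps : Set.MapsTo N (sphereIn K 1) (sphereIn K 1))
    {C : Set X} (hC : IsCompact C) (hNC : Set.MapsTo N (sphereIn K 1) C) :
    ∃ v ∈ sphereIn K 1, N v = v := by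
  have htb : TotallyBounded (N '' sphereIn K 1) := hC.totallyBounded.subset hNC.image_subset
  choose v hv hvN using fun n : ℕ => exists_approx_fixedPoint_sphereIn K hdim hN hmaps htb
    (ε := 1 / ((n : ℝ) + 1)) Nat.one_div_pos_of_nat
  obtain ⟨y, -, φ, hφ, hlim⟩ := hC.tendsto_subseq fun n => hNC (hv n)
  have hdiff : Filter.Tendsto (fun n => v (φ n) - N (v (φ n))) Filter.atTop (nhds 0) := by
    refine squeeze_zero_norm (fun n => hvN (φ n)) ?_
    have := (tendsto_one_div_add_atTop_nhds_zero_nat (𝕜 := ℝ)).comp hφ.tendsto_atTop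
    simpa using this.const_mul 4
  have hvlim : Filter.Tendsto (fun n => v (φ n)) Filter.atTop (nhds y) := by
    simpa using hdiff.add hlim
  have hyS : y ∈ sphereIn K 1 :=
    (isClosed_sphereIn K 1).mem_of_tendsto hvlim (Filter.Eventually.of_forall fun n => hv _)
  exact ⟨y, hyS, tendsto_nhds_unique ((hN y hyS).tendsto.comp
    (tendsto_nhdsWithin_iff.2 ⟨hvlim, Filter.Eventually.of_forall fun n => hv _⟩)) hlim⟩

end ConeSphere

/-! ### The maximum radius, and one fixed point per annulus. -/

section Annulus

variable {X : Type*} [NormedAddCommGroup X] [NormedSpace ℝ X]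

/-- The integrand of the radial energy, extended by a constant to negative radii. -/
noncomputable def radialDensity (T : X → X) (F : X → X → X → ℝ) (v : X) (s : ℝ) : ℝ :=
  F (T (max s 0 • v)) (max s 0 • v) v

/-- Clamping `s` at 0 keeps the arguments in `K`, the only place where `T` and `F` are known to be
continuous. -/
lemma continuous_radialDensity {K : ProperCone ℝ X} {T : X → X}
    (hT : IsCompletelyContinuous K T) {F : X → X → X → ℝ} (hF : IsContinuousFunctional K F) :
    Continuous fun p : sphereIn K 1 × ℝ => radialDensity T F p.1 p.2 := by
  have hmem : ∀ p : sphereIn K 1 × ℝ, max p.2 0 • (p.1 : X) ∈ (K : Set X) := fun p =>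
    K.smul_mem p.1.2.1 (le_max_right _ _)
  have hc : Continuous fun p : sphereIn K 1 × ℝ => max p.2 0 • (p.1 : X) := by fun_prop
  have hTc : Continuous fun p : sphereIn K 1 × ℝ => T (max p.2 0 • (p.1 : X)) :=
    hT.continuousOn.comp_continuous hc hmem
  exact ContinuousOn.comp_continuous hF (hTc.prodMk (hc.prodMk (continuous_subtype_val.comp
    continuous_fst))) fun p => ⟨hT.mapsTo (hmem p), hmem p, p.1.2⟩

lemma energy_eq_integral (T : X → X) (F : X → X → X → ℝ) (v : X) {t : ℝ} (ht : 0 ≤ t) :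
    energy T F v t = ∫ s in (0 : ℝ)..t, radialDensity T F v s := by
  refine intervalIntegral.integral_congr fun s hs => ?_
  rw [Set.uIcc_of_le ht] at hs
  simp only [radialDensity, max_eq_left hs.1]

lemma continuous_integral_radialDensity {K : ProperCone ℝ X} {T : X → X}
    (hT : IsCompletelyContinuous K T) {F : X → X → X → ℝ} (hF : IsContinuousFunctional K F) :
    Continuous fun p : sphereIn K 1 × ℝ => ∫ s in (0 : ℝ)..p.2, radialDensity T F p.1 s :=
  intervalIntegral.continuous_parametric_primitive_of_continuous
    (f := fun (v : sphereIn K 1) s => radialDensity T F v s) (continuous_radialDensity hT hF)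

lemma mem_radii_of_mem_Icc {r r₀ R₀ : ℝ} {R : EReal} (h0 : 0 < r₀) (hr : r ≤ r₀)
    (hR : (R₀ : EReal) ≤ R) {t : ℝ} (ht : t ∈ Set.Icc r₀ R₀) : t ∈ radii r R :=
  ⟨h0.trans_le ht.1, hr.trans ht.1, (EReal.coe_le_coe_iff.2 ht.2).trans hR⟩

/-- The maximum radius depends continuously on the direction. -/
theorem continuousOn_of_isMaxRadius {K : ProperCone ℝ X} {T : X → X}
    (hT : IsCompletelyContinuous K T) {F : X → X → X → ℝ} (hF : IsContinuousFunctional K F)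
    {r r₀ R₀ : ℝ} {R : EReal} (h0 : 0 < r₀) (hr : r ≤ r₀) (hR : (R₀ : EReal) ≤ R) {τ : X → ℝ}
    (hτ : ∀ v ∈ sphereIn K 1, IsMaxRadius T F r R v (τ v))
    (huniq : ∀ v ∈ sphereIn K 1, ∀ t, IsMaxRadius T F r R v t → t = τ v)
    (hmem : ∀ v ∈ sphereIn K 1, τ v ∈ Set.Icc r₀ R₀) :
    ContinuousOn τ (sphereIn K 1) := by
  rw [continuousOn_iff_continuous_domRestrict, continuous_iff_continuousAt]
  intro v
  rw [ContinuousAt, Filter.tendsto_iff_ultrafilter]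
  intro U hU
  obtain ⟨t, ht, hUt⟩ := isCompact_Icc.ultrafilter_le_nhds (U.map ((sphereIn K 1).domRestrict τ))
    (Filter.le_principal_iff.2 (Filter.mem_map.2
      (Filter.Eventually.of_forall fun w => hmem w w.2)))
  have hE := continuous_integral_radialDensity hT hF
  have h1 : Filter.Tendsto (fun w : sphereIn K 1 => ∫ s in (0 : ℝ)..τ w, radialDensity T F w s) U
      (nhds (∫ s in (0 : ℝ)..t, radialDensity T F v s)) :=
    (hE.tendsto (v, t)).comp (Filter.Tendsto.prodMk_nhds hU hUt)
  have h2 : Filter.Tendsto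
      (fun w : sphereIn K 1 => ∫ s in (0 : ℝ)..τ v, radialDensity T F w s) U
      (nhds (∫ s in (0 : ℝ)..τ v, radialDensity T F v s)) :=
    (hE.tendsto (v, τ v)).comp (Filter.Tendsto.prodMk_nhds hU tendsto_const_nhds)
  -- Nearby directions `w` compare the fixed radius `τ v` with their own maximum `τ w`; in the limit
  -- `t` is a maximum radius for `v`, hence `τ v`.
  have h3 : energy T F v (τ v) ≤ energy T F v t := by
    rw [energy_eq_integral T F v (hτ v v.2).1.1.le, energy_eq_integral T F v (h0.le.trans ht.1)]
    refine le_of_tendsto_of_tendsto' h2 h1 fun w => ?_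
    rw [← energy_eq_integral T F w (hτ v v.2).1.1.le, ← energy_eq_integral T F w (hτ w w.2).1.1.le]
    exact (hτ w w.2).2 _ (hτ v v.2).1
  have h4 : t = τ v := huniq v v.2 t ⟨mem_radii_of_mem_Icc h0 hr hR ht,
    fun s hs => ((hτ v v.2).2 s hs).trans h3⟩
  rw [h4] at hUt
  exact hUt

/-- At an interior maximum radius the integrand of the radial energy vanishes. -/
lemma IsMaxRadius.eq_zero {K : ProperCone ℝ X} {T : X → X}
    (hT : IsCompletelyContinuous K T) {F : X → X → X → ℝ} (hF : IsContinuousFunctional K F)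
    {r r₀ R₀ : ℝ} {R : EReal} (h0 : 0 < r₀) (hr : r ≤ r₀) (hR : (R₀ : EReal) ≤ R)
    {v : X} (hv : v ∈ sphereIn K 1) {t : ℝ} (ht : IsMaxRadius T F r R v t)
    (htm : t ∈ Set.Ioo r₀ R₀) : F (T (t • v)) (t • v) v = 0 := by
  have hc : Continuous (radialDensity T F v) :=
    (continuous_radialDensity hT hF).comp (Continuous.prodMk_right (⟨v, hv⟩ : sphereIn K 1))
  have hd := hc.integral_hasStrictDerivAt 0 t
  have hmax : IsLocalMax (fun t => ∫ s in (0 : ℝ)..t, radialDensity T F v s) t := by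
    filter_upwards [Ioo_mem_nhds htm.1 htm.2] with s hs
    rw [← energy_eq_integral T F v (h0.trans hs.1).le, ← energy_eq_integral T F v ht.1.1.le]
    exact ht.2 s (mem_radii_of_mem_Icc h0 hr hR (Set.Ioo_subset_Icc_self hs))
  have := hmax.hasDerivAt_eq_zero hd.hasDerivAt
  rwa [radialDensity, max_eq_left ht.1.1.le] at this

lemma norm_inv_norm_smul_self {y : X} (hy : y ≠ 0) : ‖‖y‖⁻¹ • y‖ = 1 := by
  rw [norm_smul, norm_inv, norm_norm, inv_mul_cancel₀ (norm_ne_zero_iff.2 hy)]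

/-- An admissible pair `(r, R)` yields a fixed point of `T` in the annulus `r < ‖u‖ < R`. -/
theorem Applies.exists_fixedPoint {K : ProperCone ℝ X}
    (hdim : ∀ S : Submodule ℝ X, (S : Set X) = (K : Set X) → ¬ FiniteDimensional ℝ S)
    {T : X → X} (hT : IsCompletelyContinuous K T) {F : X → X → X → ℝ}
    (hF : IsContinuousFunctional K F) {r : ℝ} {R : EReal} (h : Applies K T F r R) :
    ∃ u, IsFixedPointIn K T r R u := by
  obtain ⟨-, -, ⟨r₀, R₀, h0, hr, -, hR, hH⟩, hcases⟩ := h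
  choose! τ hτ huniq hlt hgt using hH
  have hmemIcc : ∀ v ∈ sphereIn K 1, τ v ∈ Set.Icc r₀ R₀ := fun v hv =>
    ⟨(hlt v hv).le, (hgt v hv).le⟩
  have hτpos : ∀ v ∈ sphereIn K 1, 0 < τ v := fun v hv => (hτ v hv).1.1
  have hτc := continuousOn_of_isMaxRadius hT hF h0 hr hR hτ huniq hmemIcc
  have h2 : H2 K T F r R := by rcases hcases with h | h | h <;> exact h.1
  have hman : ∀ v ∈ sphereIn K 1, τ v • v ∈ manifold K T F r R := fun v hv =>
    ⟨v, hv, τ v, hτ v hv, rfl⟩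
  set δ := ⨅ u : manifold K T F r R, ‖T u‖
  have hδpos : 0 < δ := h2
  have hδle : ∀ v ∈ sphereIn K 1, δ ≤ ‖T (τ v • v)‖ := fun v hv =>
    ciInf_le (f := fun u : manifold K T F r R => ‖T u‖)
      ⟨0, by rintro _ ⟨u, rfl⟩; exact norm_nonneg _⟩ ⟨_, hman v hv⟩
  have hK : ∀ v ∈ sphereIn K 1, τ v • v ∈ (K : Set X) := fun v hv =>
    K.smul_mem hv.1 (hτpos v hv).le
  have hnorm : ∀ v ∈ sphereIn K 1, ‖τ v • v‖ = τ v := fun v hv => by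
    rw [norm_smul, hv.2, mul_one, Real.norm_of_nonneg (hτpos v hv).le]
  have hTc : ContinuousOn (fun v => T (τ v • v)) (sphereIn K 1) :=
    hT.continuousOn.comp (hτc.smul continuousOn_id) hK
  have hTne : ∀ v ∈ sphereIn K 1, T (τ v • v) ≠ 0 := fun v hv =>
    norm_pos_iff.1 (hδpos.trans_le (hδle v hv))
  obtain ⟨v, hv, hfix⟩ := exists_fixedPoint_sphereIn K hdim
    (N := fun v => ‖T (τ v • v)‖⁻¹ • T (τ v • v))
    -- Cutting off at `δ ≤ ‖y‖`, allowed by (h2), makes normalization continuous on a compact set;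
    -- the bound `R₀` on `τ` makes the manifold bounded.
    (C := (fun y : X => ‖y‖⁻¹ • y) ''
      (closure (T '' ((K : Set X) ∩ Metric.closedBall 0 R₀)) ∩ {y | δ ≤ ‖y‖}))
    ((hTc.norm.inv₀ fun v hv => norm_ne_zero_iff.2 (hTne v hv)).smul hTc)
    (fun v hv => ⟨K.smul_mem (hT.mapsTo (hK v hv)) (by positivity),
      norm_inv_norm_smul_self (hTne v hv)⟩)
    (((hT.compact _ Set.inter_subset_left
      (Metric.isBounded_closedBall.subset Set.inter_subset_right)).inter_right
        (isClosed_le continuous_const continuous_norm)).image_of_continuousOn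
      ((continuous_norm.continuousOn.inv₀ fun y hy =>
        (hδpos.trans_le hy.2).ne').smul continuousOn_id))
    (fun v hv => ⟨_, ⟨subset_closure ⟨_, ⟨hK v hv, by
      rw [mem_closedBall_zero_iff, hnorm v hv]
      exact (hgt v hv).le⟩, rfl⟩, hδle v hv⟩, rfl⟩)
  set u := τ v • v with hu
  have hTu : 0 < ‖T u‖ := norm_pos_iff.2 (hTne v hv)
  have hvu : ‖u‖⁻¹ • u = v := by
    rw [hnorm v hv, hu, smul_smul, inv_mul_cancel₀ (hτpos v hv).ne', one_smul]
  have hupos : 0 < ‖u‖ := by rw [hnorm v hv]; exact hτpos v hv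
  have hTeq : T u = (‖T u‖ / ‖u‖) • u := by
    rw [div_eq_mul_inv, mul_smul, hvu]
    exact ((eq_inv_smul_iff₀ hTu.ne').1 hfix.symm).symm
  have hlam : 0 < ‖T u‖ / ‖u‖ := div_pos hTu hupos
  -- The critical point equation, with `T u` replaced by its multiple of `u`, is the premise of
  -- (h3), (h4) and (h5).
  have hF0 : F ((‖T u‖ / ‖u‖) • u) u (‖u‖⁻¹ • u) = 0 := by
    rw [← hTeq, hvu]
    exact IsMaxRadius.eq_zero hT hF h0 hr hR hv (hτ v hv) ⟨hlt v hv, hgt v hv⟩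
  have hone : ‖T u‖ / ‖u‖ = 1 := by
    have hu0 : u ≠ 0 := norm_pos_iff.1 hupos
    rcases hcases with ⟨-, h3⟩ | ⟨-, h4, h6⟩ | ⟨-, h5, h7⟩
    · exact h3 _ hlam u (hK v hv) hu0 hF0
    · exact le_antisymm ((div_le_one hupos).2 (h6 u (hman v hv)))
        (h4 _ hlam u (hK v hv) hu0 hF0)
    · exact le_antisymm (h5 _ hlam u (hK v hv) hu0 hF0)
        ((one_le_div hupos).2 (h7 u (hman v hv)))
  refine ⟨u, hK v hv, by rw [hTeq, hone, one_smul], ?_, ?_⟩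
  · rw [hnorm v hv]
    exact hr.trans_lt (hlt v hv)
  · rw [hnorm v hv]
    exact (EReal.coe_lt_coe_iff.2 (hgt v hv)).trans_le hR

end Annulus

/-- Any real number between the two annuli separates the norms; the resulting strict monotonicity of
norms yields injectivity of the chosen families. -/
lemma norm_lt_norm_of_isFixedPointIn {X : Type*} [NormedAddCommGroup X] [NormedSpace ℝ X]
    {K : ProperCone ℝ X} {T : X → X} {r r' : ℝ} {R R' : EReal} {u u' : X}
    (hu : IsFixedPointIn K T r R u) (hu' : IsFixedPointIn K T r' R' u') (h : R ≤ (r' : EReal)) :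
    ‖u‖ < ‖u'‖ :=
  (EReal.coe_lt_coe_iff.1 (hu.2.2.2.trans_le h)).trans hu'.2.2.1

end Nehari

theorem mainTheorem5 {X : Type*} [NormedAddCommGroup X] [NormedSpace ℝ X] [CompleteSpace X]
    (K : ProperCone ℝ X) (hK : ∃ x ∈ K, x ≠ 0)
    (hdim : ∀ S : Submodule ℝ X, (S : Set X) = (K : Set X) → ¬ FiniteDimensional ℝ S)
    (T : X → X) (hT : Nehari.IsCompletelyContinuous K T)
    (F : X → X → X → ℝ) (hF : Nehari.IsContinuousFunctional K F) :
    -- finitely many annuli, ordered increasingly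
    (∀ (n : ℕ) (r : Fin n → ℝ) (R : Fin n → EReal),
      (∀ i j : Fin n, (i : ℕ) + 1 = (j : ℕ) → R i ≤ (r j : EReal)) →
      (∀ i, Nehari.Applies K T F (r i) (R i)) →
      ∃ u : Fin n → X, Function.Injective u ∧
        ∀ i, Nehari.IsFixedPointIn K T (r i) (R i) (u i)) ∧
    -- a sequence of annuli, ordered increasingly
    (∀ (r : ℕ → ℝ) (R : ℕ → EReal),
      (∀ i, R i ≤ (r (i + 1) : EReal)) →
      (∀ i, Nehari.Applies K T F (r i) (R i)) →
      ∃ u : ℕ → X, Function.Injective u ∧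
        ∀ i, Nehari.IsFixedPointIn K T (r i) (R i) (u i)) ∧
    -- a sequence of annuli, ordered decreasingly
    (∀ (r : ℕ → ℝ) (R : ℕ → EReal),
      (∀ i, R (i + 1) ≤ (r i : EReal)) →
      (∀ i, Nehari.Applies K T F (r i) (R i)) →
      ∃ u : ℕ → X, Function.Injective u ∧
        ∀ i, Nehari.IsFixedPointIn K T (r i) (R i) (u i)) := by
  have key : ∀ {r : ℝ} {R : EReal}, Nehari.Applies K T F r R →
      ∃ u, Nehari.IsFixedPointIn K T r R u := fun h => h.exists_fixedPoint hdim hT hF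
  refine ⟨fun n r R hrR happ => ?_, fun r R hrR happ => ?_, fun r R hrR happ => ?_⟩ <;>
    choose u hu using fun i => key (happ i)
  · refine ⟨u, ?_, hu⟩
    rcases n with _ | n
    · exact fun i => i.elim0
    · have hmono : StrictMono fun i => ‖u i‖ := Fin.strictMono_iff_lt_succ.2 fun i =>
        Nehari.norm_lt_norm_of_isFixedPointIn (hu _) (hu _) (hrR _ _ (by simp))
      exact fun i j h => hmono.injective (congrArg norm h)
  · have hmono : StrictMono fun i => ‖u i‖ := strictMono_nat_of_lt_succ fun i =>
      Nehari.norm_lt_norm_of_isFixedPointIn (hu _) (hu _) (hrR i)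
    exact ⟨u, fun i j h => hmono.injective (congrArg norm h), hu⟩
  · have hanti : StrictAnti fun i => ‖u i‖ := strictAnti_nat_of_succ_lt fun i =>
      Nehari.norm_lt_norm_of_isFixedPointIn (hu _) (hu _) (hrR i)
    exact ⟨u, fun i j h => hanti.injective (congrArg norm h), hu⟩
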